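/- All Hilbert spaces are finite-dimensional, $\log$ is to base $2$, and a quantum operation is a completely positive trace-preserving map $\Phi(\rho)=\sum_k E_k\rho E_k^\dagger$, $\sum_k E_k^\dagger E_k=\mathsf{id}$. An $(r,m_A,m_B)$ two-party protocol $\Pi$ ($r\ge 1$) consists of input spaces $\mathcal A_0,\mathcal B_0$, memory spaces $\mathcal A_1,\dots,\mathcal A_r$ (Alice) and $\mathcal B_1,\dots,\mathcal B_r$ (Bob), message spaces $\mathcal X_1,\dots,\mathcal X_r$ (Alice to Bob) and $\mathcal Y_1,\dots,\mathcal Y_{r-1}$ (Bob to Alice), and quantum operations $\Phi_1:L(\mathcal A_0)\to L(\mathcal A_1\otimes\mathcal X_1)$, $\Phi_i:L(\mathcal A_{i-1}\otimes\mathcal Y_{i-1})\to L(\mathcal A_i\otimes\mathcal X_i)$ for $2\le i\le r$, $\Psi_j:L(\mathcal B_{j-1}\otimes\mathcal X_j)\to L(\mathcal B_j\otimes\mathcal Y_j)$ for $1\le j\le r-1$, and $\Psi_r:L(\mathcal B_{r-1}\otimes\mathcal X_r)\to L(\mathcal B_r)$, applied in the order $\Phi_1,\Psi_1,\dots,\Phi_r,\Psi_r$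 (each tensored with the identity on the other party's system); $\Pi(\rho)$ is the resulting state on $\mathcal A_r\otimes\mathcal B_r$. Its communication costs are $m_A=\sum_{i=1}^r\log\dim\mathcal X_i$ and $m_B=\sum_{j=1}^{r-1}\log\dim\mathcal Y_j$. For a state $\rho_{AB}$ let $$H_{\min}(A|B)_\rho=-\inf\{\lambda\in\mathbb R:\ \rho_{AB}\le 2^\lambda\,\mathsf{id}_A\otimes\sigma_B\text{ for some density operator }\sigma_B\}.$$ **Corollary.** Let $\rho_{A_0B_0}=\sum_a p_a|a\rangle\langle a|\otimes\rho^a_{B_0}$ be a cq-state, where $(|a\rangle)_a$ is an orthonormal basis of $\mathcal A_0$, $(p_a)_a$ is a probability distribution and the $\rho^a_{B_0}$ are density operators; Alice holds $A_0$ and Bob holds $B_0$. Let $\Pi$ be an $(r,m_A,m_B)$ protocol with input spaces $\mathcal A_0,\mathcal B_0$, and let $p\in(0,1]$. Suppose that Bob can recover $a$ with probability at least $p$, i.e. there is a measurement (POVM) $(E_a)_a$ on $\mathcal B_r$ with $$\sum_a p_a\,\mathrm{tr}\Big(E_a\,\mathrm{tr}_{A_r}\big(\Pi(|a\rangle\langle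 a|\otimes\rho^a_{B_0})\big)\Big)\ \ge\ p.$$ Then $$m_A+m_B\ \ge\ H_{\min}(A_0|B_0)_\rho-\log\frac1p\qquad\text{and}\qquad 2m_A\ \ge\ H_{\min}(A_0|B_0)_\rho-\log\frac1p .$$ -/

import Mathlib

open scoped Kronecker ComplexOrder

noncomputable section

namespace QComm

/-- A density operator on the Hilbert space with orthonormal basis indexed by `n`. -/
structure IsDensity {n : Type*} [Fintype n] (ρ : Matrix n n ℂ) : Prop where
  posSemidef : ρ.PosSemidef
  trace_eq_one : ρ.trace = 1

/-- Quantum operations: completely positive trace-preserving maps, in operator-sum form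
`Φ ρ = ∑ₖ Eₖ ρ Eₖ†` with `∑ₖ Eₖ† Eₖ = 1`. -/
def IsCPTP {m n : Type*} [Fintype m] [DecidableEq m] [Fintype n]
    (Φ : Matrix m m ℂ →ₗ[ℂ] Matrix n n ℂ) : Prop :=
  ∃ (N : ℕ) (E : Fin N → Matrix n m ℂ),
    (∑ k, (E k).conjTranspose * E k = 1) ∧ ∀ ρ, Φ ρ = ∑ k, E k * ρ * (E k).conjTranspose

/-- `Φ ⊗ id`: the map `Φ` applied to the left tensor factor (block by block). -/
def applyLeft {m n k : Type*} (Φ : Matrix m m ℂ →ₗ[ℂ] Matrix n n ℂ)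
    (ρ : Matrix (m × k) (m × k) ℂ) : Matrix (n × k) (n × k) ℂ :=
  Matrix.of fun i j => Φ (Matrix.of fun s t => ρ (s, i.2) (t, j.2)) i.1 j.1

/-- Exchange the first and the third of three tensor factors. -/
def swapOuter {a b c : Type*} (ρ : Matrix ((a × c) × b) ((a × c) × b) ℂ) :
    Matrix ((b × c) × a) ((b × c) × a) ℂ :=
  ρ.submatrix (fun q => ((q.2, q.1.2), q.1.1)) (fun q => ((q.2, q.1.2), q.1.1))

/-- Partial trace over the left tensor factor. -/
def traceLeft {a b : Type*} [Fintype a] (ρ : Matrix (a × b) (a × b) ℂ) : Matrix b b ℂ :=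
  Matrix.of fun i j => ∑ s, ρ (s, i) (s, j)

/-- The cq-state `∑ₐ pₐ |a⟩⟨a| ⊗ ρᵃ`. -/
def cqState {a b : Type*} [Fintype a] [DecidableEq a] (p : a → ℝ) (ρ : a → Matrix b b ℂ) :
    Matrix (a × b) (a × b) ℂ :=
  ∑ x, (p x : ℂ) • (Matrix.single x x (1 : ℂ) ⊗ₖ ρ x)

/-- The conditional min-entropy `H_min(A|B)_ρ`, minus the infimum of all real `l` such that
`ρ ≤ 2 ^ l • (1 ⊗ σ)` in the Loewner order for some density operator `σ` on `B`. -/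
def minEntropy {a b : Type*} [Fintype a] [DecidableEq a] [Fintype b]
    (ρ : Matrix (a × b) (a × b) ℂ) : ℝ :=
  -sInf {l : ℝ | ∃ σ : Matrix b b ℂ, IsDensity σ ∧
      (((2 : ℝ) ^ l) • ((1 : Matrix a a ℂ) ⊗ₖ σ) - ρ).PosSemidef}

/-- A measurement (POVM) with outcomes in `o`. -/
structure IsPOVM {o n : Type*} [Fintype o] [Fintype n] [DecidableEq n]
    (E : o → Matrix n n ℂ) : Prop where
  posSemidef : ∀ x, (E x).PosSemidef
  sum_eq_one : ∑ x, E x = 1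

/-- Two-party quantum protocols with `r = n + 1 ≥ 1` rounds, in which Alice sends the first and
the last message. `A 0`, `B 0` are the input spaces, `A 1, …, A r` and `B 1, …, B r` the memory
spaces, `X 1, …, X r` the messages from Alice to Bob and `Y 1, …, Y (r - 1)` the messages from
Bob to Alice (a type stands for the Hilbert space with a basis indexed by it; the entries of the
families at other indices play no role). Alice's operations are `alice₁` in round `1` and
`alice i` in round `i + 2`, Bob's are `bob i` in round `i + 1 < r` and `bobLast` in round `r`. -/
structure Protocol (n : ℕ) (A B X Y : ℕ → Type*)
    [∀ i, Fintype (A i)] [∀ i, DecidableEq (A i)] [∀ i, Fintype (B i)] [∀ i, DecidableEq (B i)]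
    [∀ i, Fintype (X i)] [∀ i, DecidableEq (X i)] [∀ i, Fintype (Y i)] [∀ i, DecidableEq (Y i)]
    where
  alice₁ : Matrix (A 0) (A 0) ℂ →ₗ[ℂ] Matrix (A 1 × X 1) (A 1 × X 1) ℂ
  alice : ∀ i, Matrix (A (i + 1) × Y (i + 1)) (A (i + 1) × Y (i + 1)) ℂ →ₗ[ℂ]
    Matrix (A (i + 2) × X (i + 2)) (A (i + 2) × X (i + 2)) ℂ
  bob : ∀ i, Matrix (B i × X (i + 1)) (B i × X (i + 1)) ℂ →ₗ[ℂ]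
    Matrix (B (i + 1) × Y (i + 1)) (B (i + 1) × Y (i + 1)) ℂ
  bobLast : Matrix (B n × X (n + 1)) (B n × X (n + 1)) ℂ →ₗ[ℂ]
    Matrix (B (n + 1)) (B (n + 1)) ℂ
  alice₁_cptp : IsCPTP alice₁
  alice_cptp : ∀ i < n, IsCPTP (alice i)
  bob_cptp : ∀ i < n, IsCPTP (bob i)
  bobLast_cptp : IsCPTP bobLast

namespace Protocol

variable {n : ℕ} {A B X Y : ℕ → Type*}
    [∀ i, Fintype (A i)] [∀ i, DecidableEq (A i)] [∀ i, Fintype (B i)] [∀ i, DecidableEq (B i)]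
    [∀ i, Fintype (X i)] [∀ i, DecidableEq (X i)] [∀ i, Fintype (Y i)] [∀ i, DecidableEq (Y i)]

/-- The state of Alice's memory, message and Bob's memory right after Alice's operation in
round `k + 1`. -/
def afterAlice (P : Protocol n A B X Y) (ρ : Matrix (A 0 × B 0) (A 0 × B 0) ℂ) :
    (k : ℕ) → Matrix ((A (k + 1) × X (k + 1)) × B k) ((A (k + 1) × X (k + 1)) × B k) ℂ
  | 0 => applyLeft P.alice₁ ρ
  | k + 1 =>
    applyLeft (P.alice k) (swapOuter (applyLeft (P.bob k) (swapOuter (P.afterAlice ρ k))))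

/-- The final state of the protocol, on Alice's and Bob's last memory spaces. -/
def final (P : Protocol n A B X Y) (ρ : Matrix (A 0 × B 0) (A 0 × B 0) ℂ) :
    Matrix (A (n + 1) × B (n + 1)) (A (n + 1) × B (n + 1)) ℂ :=
  (applyLeft P.bobLast (swapOuter (P.afterAlice ρ n))).submatrix Prod.swap Prod.swap

/-- `m_A`, the number of qubits sent from Alice to Bob: the sum of `log₂ dim X i`, `1 ≤ i ≤ r`. -/
def qubitsAlice (_ : Protocol n A B X Y) : ℝ :=
  ∑ i ∈ Finset.range (n + 1), Real.logb 2 (Fintype.card (X (i + 1)))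

/-- `m_B`, the number of qubits sent from Bob to Alice: the sum of `log₂ dim Y j`,
`1 ≤ j ≤ r - 1`. -/
def qubitsBob (_ : Protocol n A B X Y) : ℝ :=
  ∑ j ∈ Finset.range n, Real.logb 2 (Fintype.card (Y (j + 1)))

/-- The probability that Bob, measuring his part of the final state with `E`, obtains Alice's
classical value: this value is `a` with probability `p a`, and the protocol then runs on the input
`|a⟩⟨a| ⊗ ρᵃ`. -/
def successProb (P : Protocol n A B X Y) (p : A 0 → ℝ) (ρ : A 0 → Matrix (B 0) (B 0) ℂ)
    (E : A 0 → Matrix (B (n + 1)) (B (n + 1)) ℂ) : ℝ :=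
  ∑ a, p a * (E a * traceLeft (P.final (Matrix.single a a (1 : ℂ) ⊗ₖ ρ a))).trace.re

end Protocol

end QComm

end

namespace QComm

open Matrix
open scoped MatrixOrder

/-! ### Loewner-order inequalities. -/

section Order

variable {m n ι : Type*} [Fintype m] [Fintype n]

/-! If `ρ_{AB} ≤ 2^l • (1 ⊗ σ)`, the diagonal blocks give `q a • ρ a ≤ T` with `T = 2^l • σ`, one
bound for all `a`. Suppose Bob's final states `τ a` satisfy `q a • τ a ≤ S` with `S` independent of
`a`. Then any POVM succeeds with probability at most `∑ tr (E a * S) = tr S`. It remains to carry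
the bound through the protocol and control the trace. If `tr S = d * 2^l`, then `p ≤ d * 2^l` for
every admissible `l`, and logarithms finish.

For `m_A + m_B`, the Kraus operators of the whole run expand as `∑ᵤ |αᵤ⟩ ⊗ βᵤ` over transcripts `u`,
where only `α` depends on Alice's input. Operator Cauchy–Schwarz (`conj_sum_smul_le`) replaces `α`
by its total weight `∏ dim Y`, while `β` has total weight `∏ dim X`; so `d` is the product of the
two (`HasTranscriptForm.exists_smul_traceLeft_le`).

For `2 m_A`, the bound on Bob's marginal is propagated round by round. Receiving `X` costs `(dim
X)^2` because `ω_{BX} ≤ dim X • (ω_B ⊗ 1)` and `tr 1 = dim X`; everything else is free for Bob's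
marginal (`smul_traceLeft_bobStep_le`). -/

theorem conj_mono {S T : Matrix m m ℂ} (h : S ≤ T) (M : Matrix n m ℂ) :
    M * S * Mᴴ ≤ M * T * Mᴴ := by
  rw [Matrix.le_iff] at h ⊢
  rw [← Matrix.sub_mul, ← Matrix.mul_sub]
  exact h.mul_mul_conjTranspose_same M

theorem conj_nonneg {S : Matrix m m ℂ} (h : 0 ≤ S) (M : Matrix n m ℂ) : 0 ≤ M * S * Mᴴ := by
  simpa using conj_mono h M

/-- The operator Cauchy–Schwarz inequality. -/
theorem conj_sum_smul_le [Fintype ι] {ρ : Matrix m m ℂ} (hρ : 0 ≤ ρ) (z : ι → ℂ)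
    (M : ι → Matrix n m ℂ) :
    (∑ u, z u • M u) * ρ * (∑ u, z u • M u)ᴴ ≤ (∑ u, z u * star (z u)) • ∑ u, M u * ρ * (M u)ᴴ := by
  rw [← sub_nonneg]
  -- Lagrange's identity: the defect is a sum of positive terms.
  have key : (∑ u, z u * star (z u)) • ∑ u, M u * ρ * (M u)ᴴ
      - (∑ u, z u • M u) * ρ * (∑ u, z u • M u)ᴴ
      = ((1 / 2 : ℝ) : ℂ) • ∑ u, ∑ v, (star (z v) • M u - star (z u) • M v) * ρ *
        (star (z v) • M u - star (z u) • M v)ᴴ := by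
    have e : ∀ u v, (star (z v) • M u - star (z u) • M v) * ρ *
        (star (z v) • M u - star (z u) • M v)ᴴ
        = ((z v * star (z v)) • (M u * ρ * (M u)ᴴ) - (z u * star (z v)) • (M u * ρ * (M v)ᴴ))
        + ((z u * star (z u)) • (M v * ρ * (M v)ᴴ)
          - (z v * star (z u)) • (M v * ρ * (M u)ᴴ)) := by
      intro u v
      simp only [Matrix.conjTranspose_sub, Matrix.conjTranspose_smul, Matrix.sub_mul,
        Matrix.mul_sub, Matrix.smul_mul, Matrix.mul_smul, star_star]
      module
    have s : ∑ u, ∑ v, ((z v * star (z v)) • (M u * ρ * (M u)ᴴ)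
          - (z u * star (z v)) • (M u * ρ * (M v)ᴴ))
        = (∑ u, z u * star (z u)) • ∑ u, M u * ρ * (M u)ᴴ
      - (∑ u, z u • M u) * ρ * (∑ u, z u • M u)ᴴ := by
      simp only [Finset.sum_sub_distrib]
      congr 1
      · simp only [Finset.smul_sum, Finset.sum_smul]
      · simp only [Matrix.conjTranspose_sum, Matrix.conjTranspose_smul, Matrix.sum_mul,
          Matrix.mul_sum, Matrix.smul_mul, Matrix.mul_smul]
        rw [Finset.sum_comm]
        refine Finset.sum_congr rfl fun u _ => ?_
        rw [Finset.smul_sum]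
        refine Finset.sum_congr rfl fun v _ => ?_
        module
    simp only [e, Finset.sum_add_distrib]
    -- Exchanging `u` and `v` turns the second half into the first; the factor `1 / 2` absorbs the
    -- doubling.
    rw [Finset.sum_comm (f := fun u v => ((z u * star (z u)) • (M v * ρ * (M v)ᴴ)
          - (z v * star (z u)) • (M v * ρ * (M u)ᴴ))), s, ← two_smul ℂ, smul_smul]
    norm_num
  rw [key]
  refine smul_nonneg (by exact_mod_cast (by norm_num : (0:ℝ) ≤ 1/2)) ?_
  exact Finset.sum_nonneg fun u _ => Finset.sum_nonneg fun v _ => conj_nonneg hρ _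

theorem trace_mul_re_nonneg [DecidableEq n] {E S : Matrix n n ℂ} (hE : E.PosSemidef)
    (hS : S.PosSemidef) : 0 ≤ (E * S).trace.re := by
  obtain ⟨M, rfl⟩ := CStarAlgebra.nonneg_iff_eq_star_mul_self.mp hE.nonneg
  rw [Matrix.star_eq_conjTranspose, Matrix.mul_assoc, Matrix.trace_mul_comm]
  exact (Complex.le_def.mp (hS.mul_mul_conjTranspose_same M).trace_nonneg).1

end Order

/-! ### Channels, partial traces and Bob's step. -/

section Channels

variable {m n k a b b' x y : Type*}

theorem IsCPTP.trace_apply [Fintype m] [DecidableEq m] [Fintype n]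
    {Φ : Matrix m m ℂ →ₗ[ℂ] Matrix n n ℂ} (h : IsCPTP Φ)
    (ρ : Matrix m m ℂ) : (Φ ρ).trace = ρ.trace := by
  obtain ⟨N, E, hE, h⟩ := h
  rw [h, Matrix.trace_sum]
  calc ∑ k, (E k * ρ * (E k)ᴴ).trace = ∑ k, ((E k)ᴴ * E k * ρ).trace := by
        refine Finset.sum_congr rfl fun k _ => ?_
        rw [Matrix.trace_mul_comm, Matrix.mul_assoc]
    _ = ρ.trace := by rw [← Matrix.trace_sum, ← Matrix.sum_mul, hE, Matrix.one_mul]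

theorem IsCPTP.mono [Fintype m] [DecidableEq m] [Fintype n]
    {Φ : Matrix m m ℂ →ₗ[ℂ] Matrix n n ℂ} (h : IsCPTP Φ)
    {S T : Matrix m m ℂ} (hST : S ≤ T) : Φ S ≤ Φ T := by
  obtain ⟨N, E, hE, h⟩ := h
  rw [h, h]
  exact Finset.sum_le_sum fun k _ => conj_mono hST _

theorem applyLeft_eq_sum [Fintype m] [Fintype k] [DecidableEq k]
    {Φ : Matrix m m ℂ →ₗ[ℂ] Matrix n n ℂ}
    {N : ℕ} {E : Fin N → Matrix n m ℂ} (h : ∀ ρ, Φ ρ = ∑ k, E k * ρ * (E k)ᴴ)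
    (M : Matrix (m × k) (m × k) ℂ) :
    applyLeft Φ M = ∑ l, (E l ⊗ₖ (1 : Matrix k k ℂ)) * M * (E l ⊗ₖ (1 : Matrix k k ℂ))ᴴ := by
  ext ⟨i, c⟩ ⟨j, d⟩
  simp [applyLeft, h, Matrix.mul_apply, Matrix.sum_apply, Fintype.sum_prod_type,
    Matrix.one_apply, Finset.sum_mul, apply_ite (starRingEnd ℂ)]

theorem traceLeft_applyLeft [Fintype m] [DecidableEq m] [Fintype n]
    {Φ : Matrix m m ℂ →ₗ[ℂ] Matrix n n ℂ} (h : IsCPTP Φ)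
    (M : Matrix (m × k) (m × k) ℂ) : traceLeft (applyLeft Φ M) = traceLeft M := by
  ext i j
  simpa [traceLeft, applyLeft, Matrix.trace] using
    h.trace_apply (Matrix.of fun s t => M (s, i) (t, j))

/-- Partial trace over the right tensor factor. -/
def traceRight [Fintype b] (ρ : Matrix (a × b) (a × b) ℂ) : Matrix a a ℂ :=
  Matrix.of fun i j => ∑ s, ρ (i, s) (j, s)

theorem traceRight_applyLeft [Fintype k] (Φ : Matrix m m ℂ →ₗ[ℂ] Matrix n n ℂ)
    (M : Matrix (m × k) (m × k) ℂ) : traceRight (applyLeft Φ M) = Φ (traceRight M) := by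
  have : traceRight M = ∑ s, Matrix.of fun i j => M (i, s) (j, s) := by
    ext i j
    simp [traceRight, Matrix.sum_apply]
  rw [this, map_sum]
  ext i j
  simp [traceRight, applyLeft, Matrix.sum_apply]

theorem trace_traceRight [Fintype a] [Fintype b] (M : Matrix (a × b) (a × b) ℂ) :
    (traceRight M).trace = M.trace := by
  simp [traceRight, Matrix.trace, Fintype.sum_prod_type]

theorem traceRight_mono [Fintype a] [Fintype b] [DecidableEq a] [DecidableEq b]
    {S T : Matrix (a × b) (a × b) ℂ} (h : S ≤ T) :
    traceRight S ≤ traceRight T := by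
  have e : ∀ M : Matrix (a × b) (a × b) ℂ, traceRight M = ∑ s, M.submatrix (·, s) (·, s) := by
    intro M
    ext i j
    simp [traceRight, Matrix.sum_apply]
  rw [e, e]
  refine Finset.sum_le_sum fun s _ => ?_
  rw [Matrix.le_iff] at h ⊢
  exact h.submatrix (·, s)

/-- Bob's operation applied to Alice's memory, the message and Bob's memory. -/
def bobStep {b b' x y a : Type*} (Ψ : Matrix (b × x) (b × x) ℂ →ₗ[ℂ] Matrix (b' × y) (b' × y) ℂ)
    (M : Matrix ((a × x) × b) ((a × x) × b) ℂ) : Matrix ((a × y) × b') ((a × y) × b') ℂ :=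
  swapOuter (applyLeft Ψ (swapOuter M))

/-- Bob's operation does not touch Alice's memory, so tracing that memory out commutes with it. -/
theorem traceLeft_bobStep [Fintype a] [Fintype b] [Fintype b'] [Fintype x] [Fintype y]
    [DecidableEq b] [DecidableEq x]
    (Ψ : Matrix (b × x) (b × x) ℂ →ₗ[ℂ] Matrix (b' × y) (b' × y) ℂ)
    (M : Matrix ((a × x) × b) ((a × x) × b) ℂ) :
    traceLeft (bobStep Ψ M) = traceRight (Ψ (traceRight (swapOuter M))) := by
  rw [← traceRight_applyLeft]
  ext i j
  simp only [traceLeft, bobStep, swapOuter, traceRight, Matrix.of_apply, Matrix.submatrix_apply,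
    Fintype.sum_prod_type]
  rw [Finset.sum_comm]

/-- A Kraus operator of Bob, extended by the identity on Alice's memory. -/
def bobKraus {b b' x y : Type*} (a : Type*) [DecidableEq a] (F : Matrix (b' × y) (b × x) ℂ) :
    Matrix ((a × y) × b') ((a × x) × b) ℂ :=
  Matrix.of fun i j => if i.1.1 = j.1.1 then F (i.2, i.1.2) (j.2, j.1.2) else 0

theorem bobStep_eq_sum [Fintype a] [DecidableEq a] [Fintype b] [DecidableEq b] [Fintype x]
    [DecidableEq x] {Ψ : Matrix (b × x) (b × x) ℂ →ₗ[ℂ] Matrix (b' × y) (b' × y) ℂ}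
    [Fintype b'] [Fintype y] {N : ℕ} {F : Fin N → Matrix (b' × y) (b × x) ℂ}
    (h : ∀ ρ, Ψ ρ = ∑ k, F k * ρ * (F k)ᴴ)
    (M : Matrix ((a × x) × b) ((a × x) × b) ℂ) :
    bobStep Ψ M = ∑ l, bobKraus a (F l) * M * (bobKraus a (F l))ᴴ := by
  -- Up to this reordering of the registers, `bobKraus` is `F ⊗ 1`, which reduces the claim to
  -- `applyLeft_eq_sum`.
  let e : (b × x) × a ≃ (a × x) × b :=
    ⟨fun q => ((q.2, q.1.2), q.1.1), fun q => ((q.2, q.1.2), q.1.1), fun _ => rfl, fun _ => rfl⟩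
  let f : (a × y) × b' → (b' × y) × a := fun q => ((q.2, q.1.2), q.1.1)
  have hb : ∀ l, bobKraus a (F l) = (F l ⊗ₖ (1 : Matrix a a ℂ)).submatrix f e.symm := by
    intro l
    ext i j
    simp [bobKraus, f, e, Matrix.one_apply]
  have hM : swapOuter M = M.submatrix e e := rfl
  have hM' : M = (M.submatrix e e).submatrix e.symm e.symm := by simp
  rw [bobStep, applyLeft_eq_sum h]
  conv_rhs => rw [hM']
  simp only [hb, Matrix.conjTranspose_submatrix, Matrix.submatrix_mul_equiv]
  rw [hM]
  ext i j
  simp [swapOuter, Matrix.sum_apply, f]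

end Channels

/-! ### Cost of one message for Bob's marginal. -/

section Channels

variable {m n k a b b' x y : Type*}

theorem applyLeft_nonneg [Fintype m] [DecidableEq m] [Fintype n] [Fintype k] [DecidableEq k]
    {Φ : Matrix m m ℂ →ₗ[ℂ] Matrix n n ℂ} (h : IsCPTP Φ) {M : Matrix (m × k) (m × k) ℂ}
    (hM : 0 ≤ M) : 0 ≤ applyLeft Φ M := by
  obtain ⟨N, E, -, h⟩ := h
  rw [applyLeft_eq_sum h]
  exact Finset.sum_nonneg fun l _ => conj_nonneg hM _

variable [Fintype a] [DecidableEq a] [Fintype b] [DecidableEq b] [Fintype x] [DecidableEq x]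
  [Fintype b'] [Fintype y] {Ψ : Matrix (b × x) (b × x) ℂ →ₗ[ℂ] Matrix (b' × y) (b' × y) ℂ}

theorem bobStep_nonneg (h : IsCPTP Ψ) {M : Matrix ((a × x) × b) ((a × x) × b) ℂ}
    (hM : 0 ≤ M) : 0 ≤ bobStep Ψ M := by
  obtain ⟨N, E, -, h⟩ := h
  rw [bobStep_eq_sum h]
  exact Finset.sum_nonneg fun l _ => conj_nonneg hM _

/-- A state is dominated by its marginal times a multiple of the identity. -/
theorem le_card_smul_traceRight_kronecker {ω : Matrix (b × x) (b × x) ℂ}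
    (hω : 0 ≤ ω) :
    ω ≤ (Fintype.card x : ℂ) • (traceRight ω ⊗ₖ (1 : Matrix x x ℂ)) := by
  -- Cauchy–Schwarz for `1 = ∑ Q i i` bounds `ω` by `dim x` times its pinching. Adding the positive
  -- terms with `Q i j`, `i ≠ j`, completes the pinching to `traceRight ω ⊗ 1`.
  let Q : x → x → Matrix (b × x) (b × x) ℂ := fun i j => 1 ⊗ₖ Matrix.single i j 1
  have h1 : ∑ i, (1 : ℂ) • Q i i = 1 := by
    ext ⟨i, s⟩ ⟨j, t⟩
    simp [Q, Matrix.sum_apply, Matrix.one_apply, Matrix.single_apply, ite_and]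
    grind
  have h2 : traceRight ω ⊗ₖ (1 : Matrix x x ℂ) = ∑ i, ∑ j, Q i j * ω * (Q i j)ᴴ := by
    ext ⟨i, s⟩ ⟨j, t⟩
    simp [Q, traceRight, Matrix.sum_apply, Matrix.one_apply, Matrix.single_apply, ite_and,
      Matrix.mul_apply, Fintype.sum_prod_type, apply_ite (starRingEnd ℂ)]
    simp only [eq_comm]
  have h := conj_sum_smul_le hω (fun _ : x => (1 : ℂ)) (fun i => Q i i)
  rw [h1] at h
  simp only [Matrix.one_mul, Matrix.conjTranspose_one, star_one, mul_one,
    Finset.sum_const, Finset.card_univ, nsmul_eq_mul] at h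
  refine h.trans (smul_le_smul_of_nonneg_left ?_ (by positivity))
  rw [h2]
  exact Finset.sum_le_sum fun i _ => Finset.single_le_sum
    (f := fun j => Q i j * ω * (Q i j)ᴴ) (fun j _ => conj_nonneg hω _) (Finset.mem_univ i)

/-- Inductive step of the `2 m_A` bound. The new bound does not involve `M`, so it is again common
to all of Alice's inputs. -/
theorem smul_traceLeft_bobStep_le [DecidableEq b'] [DecidableEq y] (h : IsCPTP Ψ)
    {M : Matrix ((a × x) × b) ((a × x) × b) ℂ}
    (hM : 0 ≤ M) {q : ℝ} (hq : 0 ≤ q) {S : Matrix b b ℂ} (hS : (q : ℂ) • traceLeft M ≤ S) :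
    (q : ℂ) • traceLeft (bobStep Ψ M) ≤
      traceRight (Ψ ((Fintype.card x : ℂ) • (S ⊗ₖ (1 : Matrix x x ℂ)))) := by
  have hq' : (0 : ℂ) ≤ q := by exact_mod_cast hq
  have hω : 0 ≤ traceRight (swapOuter M) := by
    have : 0 ≤ swapOuter M := by
      rw [Matrix.le_iff, sub_zero] at hM ⊢
      exact hM.submatrix _
    have h0 : traceRight (0 : Matrix ((b × x) × a) ((b × x) × a) ℂ) = 0 := by
      ext i j
      simp [traceRight]
    exact h0 ▸ traceRight_mono this
  have e : traceRight (traceRight (swapOuter M)) = traceLeft M := by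
    ext i j
    simp only [traceLeft, swapOuter, traceRight, Matrix.of_apply, Matrix.submatrix_apply,
      Fintype.sum_prod_type]
    rw [Finset.sum_comm]
  have e2 : ∀ N : Matrix (b' × y) (b' × y) ℂ, (q : ℂ) • traceRight N = traceRight ((q : ℂ) • N) := by
    intro N
    ext i j
    simp [traceRight, Finset.mul_sum]
  rw [traceLeft_bobStep, e2, ← map_smul]
  refine traceRight_mono (h.mono ?_)
  have h1 := le_card_smul_traceRight_kronecker hω
  rw [e] at h1
  refine (smul_le_smul_of_nonneg_left h1 hq').trans ?_
  rw [smul_comm, ← Matrix.smul_kronecker]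
  refine smul_le_smul_of_nonneg_left ?_ (by positivity)
  rw [Matrix.le_iff] at hS ⊢
  have := hS.kronecker (Matrix.PosSemidef.one (n := x) (R := ℂ))
  convert this using 1
  ext i j
  simp [sub_mul]

/-- One factor `card x` is the scalar, the other is the trace of the identity on the message. -/
theorem trace_traceRight_card_smul (h : IsCPTP Ψ) (S : Matrix b b ℂ) :
    (traceRight (Ψ ((Fintype.card x : ℂ) • (S ⊗ₖ (1 : Matrix x x ℂ))))).trace =
      (Fintype.card x : ℂ) ^ 2 * S.trace := by
  rw [trace_traceRight, h.trace_apply, Matrix.trace_smul, Matrix.trace_kronecker,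
    Matrix.trace_one, smul_eq_mul]
  ring

end Channels

/-! ### Transcript expansion of the protocol. -/

section Transcripts

variable {ι a b c u : Type*}

/-- The operator `∑ᵤ |αᵤ⟩ ⊗ βᵤ`, where `αᵤ` is column `u` of `α`. -/
def join [Fintype u] (α : Matrix a u ℂ) (β : u → Matrix b c ℂ) : Matrix (a × b) c ℂ :=
  Matrix.of fun i j => ∑ v, α i.1 v * β v i.2 j

/-- The states `ω i` arise from Bob's inputs `ρ i` through operators `∑ᵤ |αᵤ⟩ ⊗ βᵤ`, where `u` runs
through transcripts of the communication, only `α` depends on `i`, and `s` and `t` are the total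
weights of `α` and `β`. -/
def HasTranscriptForm [Fintype a] [Fintype b] [Fintype c] [DecidableEq c]
    (ω : ι → Matrix (a × b) (a × b) ℂ)
    (ρ : ι → Matrix c c ℂ) (s t : ℕ) : Prop :=
  ∃ (N K L : ℕ) (α : ι → Fin K → Matrix a (Fin N) ℂ) (β : Fin L → Fin N → Matrix b c ℂ),
    (∀ i, ∑ k, ((α i k)ᴴ * α i k).trace = s) ∧
    (∑ l, ∑ v, (β l v)ᴴ * β l v = (t : ℂ) • 1) ∧
    ∀ i, ω i = ∑ k, ∑ l, join (α i k) (β l) * ρ i * (join (α i k) (β l))ᴴ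

theorem kronecker_one_mul_join [Fintype a] [Fintype b] [DecidableEq b] [Fintype u] {a' : Type*}
    (E : Matrix a' a ℂ) (α : Matrix a u ℂ)
    (β : u → Matrix b c ℂ) : (E ⊗ₖ (1 : Matrix b b ℂ)) * join α β = join (E * α) β := by
  ext ⟨i, p⟩ j
  simp only [join, Matrix.mul_apply, Fintype.sum_prod_type, kroneckerMap_apply, Matrix.one_apply,
    Matrix.of_apply, mul_ite, ite_mul, mul_one, mul_zero, zero_mul, Finset.sum_ite_eq,
    Finset.mem_univ, if_true]
  simp only [Finset.mul_sum, Finset.sum_mul, mul_assoc]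
  rw [Finset.sum_comm]

/-- A transcript grows by the basis labels of the message received and the message sent. Alice's
vector selects its `x` component and records `y`; Bob's operator picks up the corresponding block of
`F`. -/
theorem bobKraus_mul_join {b' x y : Type*} [Fintype a] [DecidableEq a] [Fintype b]
    [Fintype x] [Fintype y] [DecidableEq y]
    [Fintype u] (F : Matrix (b' × y) (b × x) ℂ) (α : Matrix (a × x) u ℂ) (β : u → Matrix b c ℂ) :
    bobKraus a F * join α β = join
      (Matrix.of fun (i : a × y) (v : u × x × y) => if i.2 = v.2.2 then α (i.1, v.2.1) v.1 else 0)
      (fun v => F.submatrix (·, v.2.2) (·, v.2.1) * β v.1) := by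
  ext ⟨⟨i, z⟩, p⟩ j
  simp only [join, bobKraus, Matrix.mul_apply, Fintype.sum_prod_type, Matrix.of_apply,
    Matrix.submatrix_apply, ite_mul, zero_mul, Finset.sum_ite_eq, Finset.mem_univ, if_true]
  rw [Finset.sum_eq_single i (fun i' _ hi => by simp [hi.symm]) (by simp)]
  simp only [if_true, Finset.mul_sum]
  conv_rhs => rw [Finset.sum_comm]
  refine Finset.sum_congr rfl fun q _ => ?_
  rw [Finset.sum_comm]
  exact Finset.sum_congr rfl fun v _ => Finset.sum_congr rfl fun r _ => by ring

variable [Fintype a] [Fintype b] [Fintype c] [DecidableEq c]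
    {ω : ι → Matrix (a × b) (a × b) ℂ} {ρ : ι → Matrix c c ℂ} {s t : ℕ}

theorem HasTranscriptForm.of_fintype {κ l : Type*} [Fintype u] [Fintype κ] [Fintype l]
    (α : ι → κ → Matrix a u ℂ) (β : l → u → Matrix b c ℂ)
    (hα : ∀ i, ∑ k, ((α i k)ᴴ * α i k).trace = s)
    (hβ : ∑ l, ∑ v, (β l v)ᴴ * β l v = (t : ℂ) • 1)
    (hω : ∀ i, ω i = ∑ k, ∑ l, join (α i k) (β l) * ρ i * (join (α i k) (β l))ᴴ) :
    HasTranscriptForm ω ρ s t := by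
  let e := (Fintype.equivFin u).symm
  let f := (Fintype.equivFin κ).symm
  let g := (Fintype.equivFin l).symm
  have hj : ∀ i k l, join ((α i k).submatrix id e) (fun v => β l (e v)) = join (α i k) (β l) := by
    intro i k l
    ext p j
    exact e.sum_comp (fun v => α i k p.1 v * β l v p.2 j)
  refine ⟨_, _, _, fun i k => (α i (f k)).submatrix id e, fun l v => β (g l) (e v),
    fun i => ?_, ?_, fun i => ?_⟩
  · rw [← hα i, ← f.sum_comp]
    refine Finset.sum_congr rfl fun k _ => ?_
    exact e.sum_comp (fun v => ((α i (f k))ᴴ * α i (f k)) v v)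
  · rw [← hβ, ← g.sum_comp]
    refine Finset.sum_congr rfl fun k _ => ?_
    exact e.sum_comp (fun v => (β (g k) v)ᴴ * β (g k) v)
  · simp only [hj, hω i]
    rw [← f.sum_comp]
    refine Finset.sum_congr rfl fun k _ => ?_
    rw [← g.sum_comp]

theorem HasTranscriptForm.applyLeft [DecidableEq a] [DecidableEq b] {a' : Type*} [Fintype a']
    (h : HasTranscriptForm ω ρ s t) {Φ : Matrix a a ℂ →ₗ[ℂ] Matrix a' a' ℂ} (hΦ : IsCPTP Φ) :
    HasTranscriptForm (fun i => QComm.applyLeft Φ (ω i)) ρ s t := by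
  obtain ⟨N, K, L, α, β, hα, hβ, hω⟩ := h
  obtain ⟨M, E, hE, hΦ⟩ := hΦ
  -- Alice's Kraus operators act on `α` alone, and `∑ E† E = 1` preserves its weight.
  refine .of_fintype (κ := Fin M × Fin K) (fun i k => E k.1 * α i k.2) β (fun i => ?_) hβ
    fun i => ?_
  · rw [← hα i, Fintype.sum_prod_type, Finset.sum_comm]
    refine Finset.sum_congr rfl fun k _ => ?_
    rw [← Matrix.trace_sum]
    simp only [Matrix.conjTranspose_mul, Matrix.mul_assoc]
    rw [← Matrix.mul_sum]
    simp only [← Matrix.mul_assoc _ _ (α i k)]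
    rw [← Matrix.sum_mul, hE, Matrix.one_mul]
  · simp only [applyLeft_eq_sum hΦ, hω, ← kronecker_one_mul_join, Fintype.sum_prod_type,
      Matrix.mul_sum, Matrix.sum_mul, Matrix.conjTranspose_mul, Matrix.mul_assoc]

/-- The weight of `α` gains `card y` since every component is repeated for each `y`. That of `β`
gains `card x` since, for each fixed `x`, the blocks of Bob's Kraus operators still satisfy the
normalization. -/
theorem HasTranscriptForm.bobStep {b' x y : Type*} [DecidableEq a] [DecidableEq b] [Fintype x]
    [DecidableEq x] [Fintype b'] [Fintype y] [DecidableEq y]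
    {ω : ι → Matrix ((a × x) × b) ((a × x) × b) ℂ}
    (h : HasTranscriptForm ω ρ s t) {Ψ : Matrix (b × x) (b × x) ℂ →ₗ[ℂ] Matrix (b' × y) (b' × y) ℂ}
    (hΨ : IsCPTP Ψ) :
    HasTranscriptForm (fun i => QComm.bobStep Ψ (ω i)) ρ
      (Fintype.card y * s) (Fintype.card x * t) := by
  obtain ⟨N, K, L, α, β, hα, hβ, hω⟩ := h
  obtain ⟨M, F, hF, hΨ⟩ := hΨ
  refine .of_fintype (κ := Fin K) (l := Fin M × Fin L) (u := Fin N × x × y)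
    (fun i k => Matrix.of fun i' v => if i'.2 = v.2.2 then α i k (i'.1, v.2.1) v.1 else 0)
    (fun l v => (F l.1).submatrix (·, v.2.2) (·, v.2.1) * β l.2 v.1) (fun i => ?_) ?_ fun i => ?_
  · rw [Nat.cast_mul, ← hα i, Finset.mul_sum]
    refine Finset.sum_congr rfl fun k _ => ?_
    simp only [Matrix.trace, Matrix.diag_apply, Matrix.mul_apply, Matrix.conjTranspose_apply,
      Fintype.sum_prod_type, Matrix.of_apply, apply_ite star, star_zero, mul_ite, ite_mul, mul_zero,
      zero_mul, Finset.sum_ite_eq', Finset.mem_univ, if_true, Finset.sum_const,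
      Finset.card_univ, nsmul_eq_mul, ← ite_and, and_self, Finset.mul_sum]
    exact Finset.sum_congr rfl fun v _ => Finset.sum_comm
  · have hF' : ∀ p : x, ∑ l, ∑ z, ((F l).submatrix (·, z) (·, p))ᴴ *
        ((F l).submatrix (·, z) (·, p)) = (1 : Matrix b b ℂ) := by
      intro p
      ext i j
      have := congr_fun (congr_fun hF (i, p)) (j, p)
      simp only [Matrix.sum_apply, Matrix.mul_apply, Fintype.sum_prod_type, Matrix.one_apply,
        Prod.mk.injEq, and_true, Matrix.conjTranspose_apply, Matrix.submatrix_apply] at this ⊢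
      rw [← this]
      exact Finset.sum_congr rfl fun l _ => Finset.sum_comm
    have e : ∀ l v (p : x), ∑ m, ∑ z, ((F m).submatrix (·, z) (·, p) * β l v)ᴴ *
        ((F m).submatrix (·, z) (·, p) * β l v) = (β l v)ᴴ * β l v := by
      intro l v p
      conv_rhs => rw [← Matrix.mul_one (β l v)ᴴ, ← hF' p]
      simp only [Matrix.mul_sum, Matrix.sum_mul, Matrix.conjTranspose_mul, Matrix.mul_assoc]
    calc _ = ∑ l, ∑ v, ∑ p : x, ∑ m, ∑ z, ((F m).submatrix (·, z) (·, p) * β l v)ᴴ *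
        ((F m).submatrix (·, z) (·, p) * β l v) := by
          simp only [Fintype.sum_prod_type]
          rw [Finset.sum_comm]
          refine Finset.sum_congr rfl fun l _ => ?_
          rw [Finset.sum_comm]
          refine Finset.sum_congr rfl fun v _ => ?_
          rw [Finset.sum_comm]
      _ = _ := by
          simp only [e, Finset.sum_const, Finset.card_univ, ← Finset.smul_sum, hβ]
          rw [← Nat.cast_smul_eq_nsmul ℂ, smul_smul, Nat.cast_mul]
  · simp only [bobStep_eq_sum hΨ, hω, ← bobKraus_mul_join, Fintype.sum_prod_type,
      Matrix.mul_sum, Matrix.sum_mul, Matrix.conjTranspose_mul, Matrix.mul_assoc]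
    rw [Finset.sum_comm]

theorem HasTranscriptForm.exists_smul_traceLeft_le [DecidableEq b]
    (h : HasTranscriptForm ω ρ s t) {q : ι → ℝ} (hq : ∀ i, 0 ≤ q i) (hρ : ∀ i, 0 ≤ ρ i)
    {T : Matrix c c ℂ} (hT : ∀ i, (q i : ℂ) • ρ i ≤ T) :
    ∃ S : Matrix b b ℂ, S.trace = s * t * T.trace ∧ ∀ i, (q i : ℂ) • traceLeft (ω i) ≤ S := by
  obtain ⟨N, K, L, α, β, hα, hβ, hω⟩ := h
  refine ⟨(s : ℂ) • ∑ l, ∑ v, β l v * T * (β l v)ᴴ, ?_, fun i => ?_⟩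
  · have e : ∀ l v, (β l v * T * (β l v)ᴴ).trace = ((β l v)ᴴ * β l v * T).trace := by
      intro l v
      rw [Matrix.trace_mul_comm, Matrix.mul_assoc]
    simp only [Matrix.trace_smul, Matrix.trace_sum, e]
    simp only [← Matrix.trace_sum, ← Matrix.sum_mul, hβ]
    simp [mul_assoc]
  -- Tracing out Alice in her basis turns the entries of `α` into scalar coefficients, ready for
  -- Cauchy–Schwarz; they then enter only through their total weight `s`, which does not depend on
  -- `i`.
  · have e : traceLeft (ω i) = ∑ k, ∑ p, ∑ l, (∑ v, α i k p v • β l v) * ρ i *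
        (∑ v, α i k p v • β l v)ᴴ := by
      have hb : ∀ k p l, ∑ v, α i k p v • β l v =
          (join (α i k) (β l)).submatrix (fun j => (p, j)) id := by
        intro k p l
        ext j d
        simp [join, Matrix.sum_apply]
      ext j d
      simp only [hb, hω, traceLeft, Matrix.of_apply, Matrix.sum_apply, Matrix.mul_apply,
        Matrix.conjTranspose_apply, Matrix.submatrix_apply, id]
      rw [Finset.sum_comm]
    have hz : ∀ k p, (0 : ℂ) ≤ ∑ v, α i k p v * star (α i k p v) := fun k p =>
      Finset.sum_nonneg fun v _ => mul_star_self_nonneg _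
    have hq' : (0 : ℂ) ≤ q i := by exact_mod_cast hq i
    calc (q i : ℂ) • traceLeft (ω i) = ∑ k, ∑ p, ∑ l, (∑ v, α i k p v • β l v) *
          ((q i : ℂ) • ρ i) * (∑ v, α i k p v • β l v)ᴴ := by
          simp only [e, Finset.smul_sum, Matrix.mul_smul, Matrix.smul_mul]
      _ ≤ ∑ k, ∑ p, ∑ l, (∑ v, α i k p v * star (α i k p v)) • ∑ v, β l v * T * (β l v)ᴴ := by
          refine Finset.sum_le_sum fun k _ => Finset.sum_le_sum fun p _ =>
            Finset.sum_le_sum fun l _ => ?_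
          refine (conj_sum_smul_le (smul_nonneg hq' (hρ i)) _ _).trans ?_
          refine smul_le_smul_of_nonneg_left ?_ (hz k p)
          exact Finset.sum_le_sum fun v _ => conj_mono (hT i) _
      _ = _ := by
          simp only [← Finset.smul_sum, ← Finset.sum_smul]
          rw [← hα i]
          congr 1
          refine Finset.sum_congr rfl fun k _ => ?_
          simp only [Matrix.trace, Matrix.diag_apply, Matrix.mul_apply, Matrix.conjTranspose_apply]
          rw [Finset.sum_comm]
          simp only [mul_comm]

end Transcripts

theorem IsPOVM.sum_smul_trace_re_le {o n : Type*} [Fintype o] [Fintype n] [DecidableEq n]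
    {E : o → Matrix n n ℂ} (hE : IsPOVM E) {q : o → ℝ} {τ : o → Matrix n n ℂ} {S : Matrix n n ℂ}
    (h : ∀ i, (q i : ℂ) • τ i ≤ S) : ∑ i, q i * (E i * τ i).trace.re ≤ S.trace.re := by
  calc ∑ i, q i * (E i * τ i).trace.re ≤ ∑ i, (E i * S).trace.re := by
        refine Finset.sum_le_sum fun i _ => ?_
        have := trace_mul_re_nonneg (hE.posSemidef i) (Matrix.le_iff.mp (h i))
        rw [Matrix.mul_sub, Matrix.trace_sub, Complex.sub_re, Matrix.mul_smul, Matrix.trace_smul,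
          smul_eq_mul, Complex.re_ofReal_mul] at this
        linarith
    _ = S.trace.re := by
        rw [← Complex.re_sum, ← Matrix.trace_sum, ← Matrix.sum_mul, hE.sum_eq_one, Matrix.one_mul]

/-! ### The cq input state. -/

section Inputs

variable {a b : Type*} [Fintype a] [DecidableEq a]

theorem smul_le_of_cqState_le {q : a → ℝ} {ρ : a → Matrix b b ℂ} {σ : Matrix b b ℂ} {c : ℝ}
    (h : (c • ((1 : Matrix a a ℂ) ⊗ₖ σ) - cqState q ρ).PosSemidef) (i : a) :
    (q i : ℂ) • ρ i ≤ (c : ℂ) • σ := by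
  rw [Matrix.le_iff]
  have e : (c : ℂ) • σ - (q i : ℂ) • ρ i = (c • ((1 : Matrix a a ℂ) ⊗ₖ σ) - cqState q ρ).submatrix
      (fun j : b => (i, j)) (fun j : b => (i, j)) := by
    ext j k
    simp [cqState, Matrix.sum_apply, Matrix.single_apply]
  rw [e]
  exact h.submatrix _

variable [Fintype b]

theorem single_kronecker_nonneg {ρ : Matrix b b ℂ} (hρ : 0 ≤ ρ) (i : a) :
    0 ≤ Matrix.single i i (1 : ℂ) ⊗ₖ ρ := by
  rw [Matrix.nonneg_iff_posSemidef] at hρ ⊢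
  refine Matrix.PosSemidef.kronecker ?_ hρ
  have : Matrix.single i i (1 : ℂ) = Matrix.diagonal (Pi.single i 1) := by
    rw [Matrix.diagonal_single]
  rw [this, Matrix.posSemidef_diagonal_iff]
  intro j
  by_cases h : j = i <;> simp [h]

variable [DecidableEq b]

/-- Before any communication there is one empty transcript, with `α = |i⟩` and `β = 1`. -/
theorem hasTranscriptForm_single_kronecker (ρ : a → Matrix b b ℂ) :
    HasTranscriptForm (fun i => Matrix.single i i (1 : ℂ) ⊗ₖ ρ i) ρ 1 1 := by
  refine .of_fintype (u := Unit) (κ := Unit) (l := Unit)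
    (fun i _ => Matrix.of fun j _ => if i = j then 1 else 0) (fun _ _ => 1) ?_ ?_ ?_
  · intro i
    simp [Matrix.trace, Matrix.mul_apply]
  · simp
  · intro i
    ext ⟨j, s⟩ ⟨k, t⟩
    simp [join, Matrix.mul_apply, Matrix.single_apply, Matrix.one_apply, ite_and,
      apply_ite (starRingEnd ℂ)]
    grind

end Inputs

/-! ### The two bounds on the success probability. -/

namespace Protocol

variable {n : ℕ} {A B X Y : ℕ → Type*}
    [∀ i, Fintype (A i)] [∀ i, DecidableEq (A i)] [∀ i, Fintype (B i)] [∀ i, DecidableEq (B i)]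
    [∀ i, Fintype (X i)] [∀ i, DecidableEq (X i)] [∀ i, Fintype (Y i)] [∀ i, DecidableEq (Y i)]

theorem afterAlice_succ (P : Protocol n A B X Y) (ρ : Matrix (A 0 × B 0) (A 0 × B 0) ℂ) (k : ℕ) :
    P.afterAlice ρ (k + 1) = applyLeft (P.alice k) (bobStep (P.bob k) (P.afterAlice ρ k)) := rfl

/-- Bob's last operation, sending a trivial message back to Alice. -/
def bobLastUnit (P : Protocol n A B X Y) : Matrix (B n × X (n + 1)) (B n × X (n + 1)) ℂ →ₗ[ℂ]
    Matrix (B (n + 1) × Unit) (B (n + 1) × Unit) ℂ where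
  toFun M := (P.bobLast M).submatrix Prod.fst Prod.fst
  map_add' M N := by simp [Matrix.submatrix_add]
  map_smul' c M := by simp [Matrix.submatrix_smul]

theorem bobLastUnit_cptp (P : Protocol n A B X Y) : IsCPTP P.bobLastUnit := by
  obtain ⟨N, E, hE, h⟩ := P.bobLast_cptp
  refine ⟨N, fun k => (E k).submatrix Prod.fst id, ?_, fun ρ => ?_⟩
  · rw [← hE]
    refine Finset.sum_congr rfl fun k _ => ?_
    ext i j
    simp [Matrix.mul_apply, Fintype.sum_prod_type]
  · ext i j
    simp [bobLastUnit, h, Matrix.sum_apply, Matrix.mul_apply]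

/-- Makes the last round an ordinary Bob step with a reply of dimension `1`, so it adds no factor
for `Y`. -/
theorem traceLeft_final (P : Protocol n A B X Y) (ρ : Matrix (A 0 × B 0) (A 0 × B 0) ℂ) :
    traceLeft (P.final ρ) = traceLeft (bobStep P.bobLastUnit (P.afterAlice ρ n)) := by
  ext i j
  simp [traceLeft, final, bobStep, swapOuter, applyLeft, bobLastUnit, Fintype.sum_prod_type]

theorem hasTranscriptForm_afterAlice (P : Protocol n A B X Y) (ρ : A 0 → Matrix (B 0) (B 0) ℂ)
    {k : ℕ} (hk : k ≤ n) :
    HasTranscriptForm (fun a => P.afterAlice (Matrix.single a a (1 : ℂ) ⊗ₖ ρ a) k) ρ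
      (∏ i ∈ Finset.range k, Fintype.card (Y (i + 1)))
      (∏ i ∈ Finset.range k, Fintype.card (X (i + 1))) := by
  induction k with
  | zero => exact (hasTranscriptForm_single_kronecker ρ).applyLeft P.alice₁_cptp
  | succ k ih =>
    rw [Finset.prod_range_succ, Finset.prod_range_succ, mul_comm, mul_comm _ (Fintype.card (X _))]
    exact ((ih (by omega)).bobStep (P.bob_cptp k (by omega))).applyLeft (P.alice_cptp k (by omega))

theorem afterAlice_nonneg (P : Protocol n A B X Y) {ρ : Matrix (A 0 × B 0) (A 0 × B 0) ℂ}
    (hρ : 0 ≤ ρ) {k : ℕ} (hk : k ≤ n) : 0 ≤ P.afterAlice ρ k := by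
  induction k with
  | zero => exact applyLeft_nonneg P.alice₁_cptp hρ
  | succ k ih =>
    exact applyLeft_nonneg (P.alice_cptp k (by omega))
      (bobStep_nonneg (P.bob_cptp k (by omega)) (ih (by omega)))

variable {P : Protocol n A B X Y} {q : A 0 → ℝ} {ρ : A 0 → Matrix (B 0) (B 0) ℂ}
  {T : Matrix (B 0) (B 0) ℂ}

/-- Alice's operations leave Bob's marginal unchanged, and his replies are merely traced out of it;
only the messages `X` contribute. -/
theorem exists_smul_traceLeft_afterAlice_le (hq : ∀ a, 0 ≤ q a) (hρ : ∀ a, 0 ≤ ρ a)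
    (hT : ∀ a, (q a : ℂ) • ρ a ≤ T) {k : ℕ} (hk : k ≤ n) :
    ∃ S : Matrix (B k) (B k) ℂ,
      S.trace = (∏ i ∈ Finset.range k, (Fintype.card (X (i + 1)) : ℂ) ^ 2) * T.trace ∧
      ∀ a, (q a : ℂ) • traceLeft (P.afterAlice (Matrix.single a a (1 : ℂ) ⊗ₖ ρ a) k) ≤ S := by
  induction k with
  | zero =>
    refine ⟨T, by simp, fun a => ?_⟩
    convert hT a using 2
    rw [afterAlice, traceLeft_applyLeft P.alice₁_cptp]
    ext i j
    simp [traceLeft, Matrix.single_apply]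
  | succ k ih =>
    obtain ⟨S, hS, h⟩ := ih (by omega)
    have hb := P.bob_cptp k (by omega)
    refine ⟨traceRight (P.bob k ((Fintype.card (X (k + 1)) : ℂ) •
      (S ⊗ₖ (1 : Matrix (X (k + 1)) (X (k + 1)) ℂ)))), ?_, fun a => ?_⟩
    · rw [trace_traceRight_card_smul hb, hS, Finset.prod_range_succ]
      ring
    · rw [afterAlice_succ, traceLeft_applyLeft (P.alice_cptp k (by omega))]
      exact smul_traceLeft_bobStep_le hb
        (P.afterAlice_nonneg (single_kronecker_nonneg (hρ a) a) (by omega)) (hq a) (h a)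

theorem successProb_le_card_mul_card (hq : ∀ a, 0 ≤ q a) (hρ : ∀ a, 0 ≤ ρ a)
    (hT : ∀ a, (q a : ℂ) • ρ a ≤ T) {E : A 0 → Matrix (B (n + 1)) (B (n + 1)) ℂ} (hE : IsPOVM E) :
    P.successProb q ρ E ≤ (∏ i ∈ Finset.range n, (Fintype.card (Y (i + 1)) : ℝ)) *
      (∏ i ∈ Finset.range (n + 1), (Fintype.card (X (i + 1)) : ℝ)) * T.trace.re := by
  obtain ⟨S, hS, h⟩ := ((P.hasTranscriptForm_afterAlice ρ le_rfl).bobStep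
    P.bobLastUnit_cptp).exists_smul_traceLeft_le hq hρ hT
  simp only [← traceLeft_final] at h
  refine (hE.sum_smul_trace_re_le h).trans_eq ?_
  rw [hS, ← Complex.re_ofReal_mul, Finset.prod_range_succ]
  congr 1
  push_cast
  simp only [Fintype.card_unit, Nat.cast_one]
  ring

theorem successProb_le_card_sq (hq : ∀ a, 0 ≤ q a) (hρ : ∀ a, 0 ≤ ρ a)
    (hT : ∀ a, (q a : ℂ) • ρ a ≤ T) {E : A 0 → Matrix (B (n + 1)) (B (n + 1)) ℂ} (hE : IsPOVM E) :
    P.successProb q ρ E ≤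
      (∏ i ∈ Finset.range (n + 1), (Fintype.card (X (i + 1)) : ℝ)) ^ 2 * T.trace.re := by
  obtain ⟨S, hS, h⟩ := exists_smul_traceLeft_afterAlice_le (P := P) hq hρ hT le_rfl
  have h' := fun a => smul_traceLeft_bobStep_le P.bobLastUnit_cptp
    (P.afterAlice_nonneg (single_kronecker_nonneg (hρ a) a) le_rfl) (hq a) (h a)
  simp only [← traceLeft_final] at h'
  refine (hE.sum_smul_trace_re_le h').trans_eq ?_
  rw [trace_traceRight_card_smul P.bobLastUnit_cptp, hS, ← Complex.re_ofReal_mul,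
    ← Finset.prod_pow, Finset.prod_range_succ]
  congr 1
  push_cast
  ring

end Protocol

/-! ### From success probability to min-entropy. -/

/-- The set of exponents in the definition of the min-entropy of a cq-state is nonempty. -/
theorem exists_cqState_le {a b : Type*} [Fintype a] [DecidableEq a] [Fintype b] [DecidableEq b]
    {q : a → ℝ} (hq : ∀ i, 0 ≤ q i) (hq1 : ∑ i, q i = 1) {ρ : a → Matrix b b ℂ}
    (hρ : ∀ i, IsDensity (ρ i)) :
    ∃ l : ℝ, ∃ σ : Matrix b b ℂ, IsDensity σ ∧
      (((2 : ℝ) ^ l) • ((1 : Matrix a a ℂ) ⊗ₖ σ) - cqState q ρ).PosSemidef := by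
  have hq' : ∀ i, (0 : ℂ) ≤ q i := fun i => by exact_mod_cast hq i
  -- With `σ` Bob's average state, `1 ⊗ σ` minus the cq-state consists of the positive terms `q i •
  -- |j⟩⟨j| ⊗ ρ i` with `i ≠ j`.
  refine ⟨0, ∑ i, (q i : ℂ) • ρ i, ⟨?_, ?_⟩, ?_⟩
  · exact Matrix.posSemidef_sum _ fun i _ => (hρ i).posSemidef.smul (hq' i)
  · simp only [Matrix.trace_sum, Matrix.trace_smul, (hρ _).trace_eq_one, smul_eq_mul, mul_one]
    exact_mod_cast hq1
  · have : ((2 : ℝ) ^ (0 : ℝ)) • ((1 : Matrix a a ℂ) ⊗ₖ ∑ i, (q i : ℂ) • ρ i) - cqState q ρ =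
        ∑ j, ∑ i ∈ Finset.univ.erase j,
          (q i : ℂ) • (Matrix.single j j (1 : ℂ) ⊗ₖ ρ i) := by
      rw [Real.rpow_zero, one_smul, sub_eq_iff_eq_add, cqState, ← Finset.sum_add_distrib]
      simp only [Finset.sum_erase_add _ _ (Finset.mem_univ _)]
      ext ⟨i, s⟩ ⟨j, t⟩
      simp [Matrix.sum_apply, Matrix.one_apply, Matrix.single_apply, ite_and, Finset.mul_sum]
    rw [this]
    exact Matrix.posSemidef_sum _ fun j _ => Matrix.posSemidef_sum _ fun i _ =>
      (Matrix.nonneg_iff_posSemidef.mp (single_kronecker_nonneg (hρ i).posSemidef.nonneg j)).smul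
        (hq' i)

theorem minEntropy_sub_logb_le {a b : Type*} [Fintype a] [DecidableEq a] [Fintype b]
    {ω : Matrix (a × b) (a × b) ℂ} {p d : ℝ} (hp : 0 < p)
    (hω : ∃ l : ℝ, ∃ σ : Matrix b b ℂ, IsDensity σ ∧
      (((2 : ℝ) ^ l) • ((1 : Matrix a a ℂ) ⊗ₖ σ) - ω).PosSemidef)
    (h : ∀ (l : ℝ) (σ : Matrix b b ℂ), IsDensity σ →
      (((2 : ℝ) ^ l) • ((1 : Matrix a a ℂ) ⊗ₖ σ) - ω).PosSemidef → p ≤ d * 2 ^ l) :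
    minEntropy ω - Real.logb 2 (1 / p) ≤ Real.logb 2 d := by
  have : Real.logb 2 p - Real.logb 2 d ≤ sInf {l : ℝ | ∃ σ : Matrix b b ℂ, IsDensity σ ∧
      (((2 : ℝ) ^ l) • ((1 : Matrix a a ℂ) ⊗ₖ σ) - ω).PosSemidef} := by
    refine le_csInf hω ?_
    rintro l ⟨σ, hσ, hl⟩
    have hpl := h l σ hσ hl
    have hl0 : (0 : ℝ) < 2 ^ l := by positivity
    have hd0 : d ≠ 0 := by
      rintro rfl
      linarith [zero_mul ((2 : ℝ) ^ l)]
    have := Real.logb_le_logb_of_le one_lt_two hp hpl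
    rw [Real.logb_mul hd0 hl0.ne', Real.logb_rpow two_pos (by norm_num)] at this
    linarith
  rw [minEntropy, one_div, Real.logb_inv]
  linarith

end QComm

theorem mainTheorem3 {n : ℕ} {A B X Y : ℕ → Type*}
    [∀ i, Fintype (A i)] [∀ i, DecidableEq (A i)] [∀ i, Fintype (B i)] [∀ i, DecidableEq (B i)]
    [∀ i, Fintype (X i)] [∀ i, DecidableEq (X i)] [∀ i, Fintype (Y i)] [∀ i, DecidableEq (Y i)]
    (P : QComm.Protocol n A B X Y)
    (q : A 0 → ℝ) (hq : ∀ a, 0 ≤ q a) (hq1 : ∑ a, q a = 1)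
    (ρ : A 0 → Matrix (B 0) (B 0) ℂ) (hρ : ∀ a, QComm.IsDensity (ρ a))
    (p : ℝ) (hp : 0 < p) (hp1 : p ≤ 1)
    (hrec : ∃ E : A 0 → Matrix (B (n + 1)) (B (n + 1)) ℂ,
      QComm.IsPOVM E ∧ p ≤ P.successProb q ρ E) :
    QComm.minEntropy (QComm.cqState q ρ) - Real.logb 2 (1 / p) ≤ P.qubitsBob + P.qubitsAlice ∧
    QComm.minEntropy (QComm.cqState q ρ) - Real.logb 2 (1 / p) ≤ 2 * P.qubitsAlice := by
  obtain ⟨E, hE, hpE⟩ := hrec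
  have hρ' := fun a => (hρ a).posSemidef.nonneg
  have htr : ∀ (l : ℝ) (σ : Matrix (B 0) (B 0) ℂ), QComm.IsDensity σ →
      ((((2 : ℝ) ^ l : ℝ) : ℂ) • σ).trace.re = 2 ^ l := fun l σ hσ => by
    rw [Matrix.trace_smul, hσ.trace_eq_one, smul_eq_mul, mul_one, Complex.ofReal_re]
  have hex := QComm.exists_cqState_le hq hq1 hρ
  have h1 : ∀ (l : ℝ) (σ : Matrix (B 0) (B 0) ℂ), QComm.IsDensity σ →
      (((2 : ℝ) ^ l) • ((1 : Matrix (A 0) (A 0) ℂ) ⊗ₖ σ) - QComm.cqState q ρ).PosSemidef →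
      p ≤ (∏ i ∈ Finset.range n, (Fintype.card (Y (i + 1)) : ℝ)) *
        (∏ i ∈ Finset.range (n + 1), (Fintype.card (X (i + 1)) : ℝ)) * 2 ^ l := by
    intro l σ hσ hl
    have := QComm.Protocol.successProb_le_card_mul_card (P := P) hq hρ'
      (QComm.smul_le_of_cqState_le hl) hE
    rw [htr l σ hσ] at this
    exact hpE.trans this
  have h2 : ∀ (l : ℝ) (σ : Matrix (B 0) (B 0) ℂ), QComm.IsDensity σ →
      (((2 : ℝ) ^ l) • ((1 : Matrix (A 0) (A 0) ℂ) ⊗ₖ σ) - QComm.cqState q ρ).PosSemidef →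
      p ≤ (∏ i ∈ Finset.range (n + 1), (Fintype.card (X (i + 1)) : ℝ)) ^ 2 * 2 ^ l := by
    intro l σ hσ hl
    have := QComm.Protocol.successProb_le_card_sq (P := P) hq hρ'
      (QComm.smul_le_of_cqState_le hl) hE
    rw [htr l σ hσ] at this
    exact hpE.trans this
  -- Splitting the logarithm of a product needs nonzero dimensions; an empty message type would
  -- force `p ≤ 0`.
  obtain ⟨hY, hX⟩ : (∏ i ∈ Finset.range n, (Fintype.card (Y (i + 1)) : ℝ)) ≠ 0 ∧
      (∏ i ∈ Finset.range (n + 1), (Fintype.card (X (i + 1)) : ℝ)) ≠ 0 := by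
    obtain ⟨l, σ, hσ, hl⟩ := hex
    have := hp.trans_le (h1 l σ hσ hl)
    exact ⟨left_ne_zero_of_mul (left_ne_zero_of_mul this.ne'),
      right_ne_zero_of_mul (left_ne_zero_of_mul this.ne')⟩
  refine ⟨(QComm.minEntropy_sub_logb_le hp hex h1).trans_eq ?_,
    (QComm.minEntropy_sub_logb_le hp hex h2).trans_eq ?_⟩
  · rw [Real.logb_mul hY hX, Real.logb_prod _ _ (Finset.prod_ne_zero_iff.mp hY),
      Real.logb_prod _ _ (Finset.prod_ne_zero_iff.mp hX)]
    rfl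
  · rw [Real.logb_pow, Real.logb_prod _ _ (Finset.prod_ne_zero_iff.mp hX)]
    simp [QComm.Protocol.qubitsAlice]
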